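/- Let $0\le k\le n$. Let $\mathcal J(\mathbb R^{2n})=\{J\in\operatorname{End}(\mathbb R^{2n}) : J^2=-\mathrm{Id}\}$ be the space of linear complex structures on $\mathbb R^{2n}$, with the subspace topology, and let $\operatorname{Gr}^+_{2k}(\mathbb R^{2n})$ be the Grassmannian of oriented $2k$-planes, a smooth manifold with the standard charts $A\mapsto \operatorname{graph}(A)$, $A\in\operatorname{Hom}(P,Q)$, where $P$ is an oriented $2k$-plane, $\mathbb R^{2n}=P\oplus Q$, and $\operatorname{graph}(A)$ is oriented through the isomorphism $P\to\operatorname{graph}(A)$, $v\mapsto v+Av$. For $J\in\mathcal J(\mathbb R^{2n})$ let $\operatorname{Gr}^J_{2k}\subset \operatorname{Gr}^+_{2k}(\mathbb R^{2n})$ be the submanifold of all $2k$-planes $P$ with $J(P)=P$, each with the orientation induced by $J$ (the one for which the bases $(v_1,Jv_1,\dots,v_k,Jv_k)$ of $P$ are positive). Let $\tau$ be the involution of $\operatorname{Gr}^+_{2k}(\mathbb R^{2n})$ that reverses the orientation of each plane. Two submanifolds $S,S'$ of $\operatorname{Gr}^+_{2k}(\mathbb R^{2n})$ intersect transversally if $T_PS+T_PS'=T_P\operatorname{Gr}^+_{2k}(\mathbb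 R^{2n})$ for every $P\in S\cap S'$ (in particular if $S\cap S'=\emptyset$). Then the set of pairs $(J,J')\in\mathcal J(\mathbb R^{2n})\times\mathcal J(\mathbb R^{2n})$ such that $\operatorname{Gr}^J_{2k}$ and $\operatorname{Gr}^{J'}_{2k}$ intersect transversally and $\operatorname{Gr}^J_{2k}\cap\operatorname{Gr}^{J'}_{2k}$ is finite contains an open dense subset of $\mathcal J(\mathbb R^{2n})\times\mathcal J(\mathbb R^{2n})$. Likewise, the set of pairs $(J,J')$ such that $\operatorname{Gr}^J_{2k}$ and $\tau(\operatorname{Gr}^{J'}_{2k})$ intersect transversally and $\operatorname{Gr}^J_{2k}\cap\tau(\operatorname{Gr}^{J'}_{2k})$ is finite contains an open dense subset of $\mathcal J(\mathbb R^{2n})\times\mathcal J(\mathbb R^{2n})$. -/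

import Mathlib

open scoped Topology ContDiff

/-- The real vector space `ℝ^{2n}`. -/
abbrev RealSpace (n : ℕ) : Type := EuclideanSpace ℝ (Fin (2 * n))

/-- The space of (linear) complex structures on `ℝ^{2n}`, with the subspace topology from
`End(ℝ^{2n})`. -/
abbrev ComplexStructure (n : ℕ) : Type :=
  {J : RealSpace n →L[ℝ] RealSpace n // J ∘L J = -ContinuousLinearMap.id ℝ (RealSpace n)}

/-- The Grassmannian `Gr⁺_{2k}(ℝ^{2n})` of oriented `2k`-planes in `ℝ^{2n}`. -/
@[ext] structure OrientedGr (n k : ℕ) where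
  /-- the underlying plane -/
  plane : Submodule ℝ (RealSpace n)
  finrank_plane : Module.finrank ℝ plane = 2 * k
  /-- the orientation of the plane -/
  orientation : Orientation ℝ plane (Fin (2 * k))

namespace OrientedGr

variable {n k : ℕ}

/-- The involution `τ` which switches the orientation of each plane. -/
def tau (P : OrientedGr n k) : OrientedGr n k :=
  ⟨P.plane, P.finrank_plane, -P.orientation⟩

/-- The map `v ↦ v + A v` from `P` to `ℝ^{2n}`, whose image is the graph of `A : P → Q`. -/
def graphMap (P : OrientedGr n k) (Q : Submodule ℝ (RealSpace n)) (A : P.plane →ₗ[ℝ] Q) :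
    P.plane →ₗ[ℝ] RealSpace n :=
  P.plane.subtype + Q.subtype ∘ₗ A

theorem graphMap_injective (P : OrientedGr n k) {Q : Submodule ℝ (RealSpace n)}
    (hQ : IsCompl P.plane Q) (A : P.plane →ₗ[ℝ] Q) :
    Function.Injective (P.graphMap Q A) := by
  rw [← LinearMap.ker_eq_bot, LinearMap.ker_eq_bot']
  intro v hv
  have h : (v : RealSpace n) + (A v : RealSpace n) = 0 := hv
  have hvQ : (v : RealSpace n) ∈ Q := by
    rw [eq_neg_of_add_eq_zero_left h]
    exact Q.neg_mem (A v).2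
  exact Subtype.ext (Submodule.disjoint_def.1 hQ.disjoint _ v.2 hvQ)

/-- The linear isomorphism `v ↦ v + A v` from `P` onto the graph of `A : P → Q`, where `Q` is a
complement of `P`. -/
noncomputable def graphEquiv (P : OrientedGr n k) {Q : Submodule ℝ (RealSpace n)}
    (hQ : IsCompl P.plane Q) (A : P.plane →ₗ[ℝ] Q) :
    P.plane ≃ₗ[ℝ] LinearMap.range (P.graphMap Q A) :=
  LinearEquiv.ofInjective (P.graphMap Q A) (P.graphMap_injective hQ A)

/-- The inverse of the standard chart of `Gr⁺_{2k}(ℝ^{2n})` centred at `P` that is given by a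
complement `Q` of `P`: it sends `A ∈ Hom(P, Q)` to the graph of `A`, with the orientation
carried over from `P` by `v ↦ v + A v`. -/
noncomputable def graph (P : OrientedGr n k) {Q : Submodule ℝ (RealSpace n)}
    (hQ : IsCompl P.plane Q) (A : P.plane →ₗ[ℝ] Q) : OrientedGr n k where
  plane := LinearMap.range (P.graphMap Q A)
  finrank_plane := (P.graphEquiv hQ A).finrank_eq.symm.trans P.finrank_plane
  orientation := Orientation.map (Fin (2 * k)) (P.graphEquiv hQ A) P.orientation

/-- The tangent vectors at `P` of a submanifold `S` of `Gr⁺_{2k}(ℝ^{2n})`, in the standard chart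
`Hom(P, Q)` centred at `P`: the velocities `B` at time `0` of the smooth curves
`γ : (-ε, ε) → Hom(P, Q)` with `γ 0 = 0` whose images in `Gr⁺_{2k}(ℝ^{2n})` stay in `S`.
As `Hom(P, Q)` is finite-dimensional, smoothness and derivative of `γ` are those of all its
evaluations `t ↦ γ t v`. -/
def tangentVectors (S : Set (OrientedGr n k)) (P : OrientedGr n k)
    {Q : Submodule ℝ (RealSpace n)} (hQ : IsCompl P.plane Q) : Set (P.plane →ₗ[ℝ] Q) :=
  {B | ∃ ε > 0, ∃ γ : ℝ → (P.plane →ₗ[ℝ] Q),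
    (∀ v : P.plane, ContDiffOn ℝ ∞ (fun t => γ t v) (Set.Ioo (-ε) ε)) ∧
    (∀ t ∈ Set.Ioo (-ε) ε, P.graph hQ (γ t) ∈ S) ∧
    γ 0 = 0 ∧ ∀ v : P.plane, HasDerivAt (fun t => γ t v) (B v) 0}

/-- The submanifolds `S` and `S'` of `Gr⁺_{2k}(ℝ^{2n})` intersect transversally: at each common
point `P`, in each standard chart `Hom(P, Q)` centred at `P`,
`T_P S + T_P S' = T_P Gr⁺_{2k}(ℝ^{2n}) = Hom(P, Q)`. -/
def IntersectTransversally (S S' : Set (OrientedGr n k)) : Prop :=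
  ∀ P ∈ S ∩ S', ∀ (Q : Submodule ℝ (RealSpace n)) (hQ : IsCompl P.plane Q)
    (B : P.plane →ₗ[ℝ] Q),
    ∃ B₁ ∈ tangentVectors S P hQ, ∃ B₂ ∈ tangentVectors S' P hQ, B = B₁ + B₂

end OrientedGr

/-- The orientation `o` of `P` is the one induced by the complex structure `J`: some real basis
of `P` of the form `(v₁, J v₁, …, v_k, J v_k)` is positive. -/
def IsInducedOrientation {n k : ℕ} (J : ComplexStructure n) (P : Submodule ℝ (RealSpace n))
    (o : Orientation ℝ P (Fin (2 * k))) : Prop :=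
  ∃ b : Module.Basis (Fin (2 * k)) ℝ P,
    (∀ i : Fin k, (b ⟨2 * i + 1, by omega⟩ : RealSpace n) =
      J.1 (b ⟨2 * i, by omega⟩ : RealSpace n)) ∧
    b.orientation = o

/-- The complex Grassmannian `Gr^J_{2k}(ℝ^{2n})` in `Gr⁺_{2k}(ℝ^{2n})`: the `2k`-planes `P` with
`J(P) = P`, with the orientation induced by `J`. -/
def complexGr {n : ℕ} (k : ℕ) (J : ComplexStructure n) : Set (OrientedGr n k) :=
  {P | P.plane.map (J.1 : RealSpace n →ₗ[ℝ] RealSpace n) = P.plane ∧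
    IsInducedOrientation J P.plane P.orientation}

/-! Both statements hold on one open dense set, independent of `k`: the pairs for which `R = J J'`
has nonzero discriminant, that is, distinct complex eigenvalues.

Finiteness. A plane invariant under `J` and `J'` is invariant under `R`. The minimal polynomial of
such an `R` is squarefree of full degree, and an invariant subspace `P` is the kernel of `a(R)`,
where `a` is the minimal polynomial of `R` on `P`. There are finitely many monic divisors `a`, and
each plane has two orientations (`finite_setOf_invariant`).

Transversality. In the chart `Hom(P, Q)` with `Q ≃ V ⧸ P`, the `J`-linear maps are tangent to the
complex Grassmannian of `J` (`mem_tangentVectors_complexGr`). They are the fixed points of the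
involution `σ C = -J C J`; likewise `σ'` for `J'`. A map fixed by `σ σ'` intertwines `R` on `P` with
`R` on `V ⧸ P`, whose minimal polynomials are coprime, so it is zero. Hence `1 - σ σ'` is
invertible, and `C - σ σ' C = (C + σ' C) - (σ' C + σ σ' C)` splits every map into a `J'`-linear and
a `J`-linear one.

Density. Some conjugate of `J'` by a matrix `G` makes the discriminant nonzero. Along the line `1 +
t (G - 1)` the discriminant is, up to a nonzero factor where the matrix is invertible, a polynomial
in `t` that is nonzero at `t = 1`. So it is nonzero for all small `t ≠ 0`. -/

/-- The discriminant of an endomorphism `R`, up to sign the discriminant of its characteristic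
polynomial: the determinant of the matrix of the traces of `R ^ (i + j)`. -/
noncomputable def traceDiscr {V : Type*} [AddCommGroup V] [Module ℝ V] (N : ℕ)
    (R : Module.End ℝ V) : ℝ :=
  (Matrix.of fun i j : Fin N => LinearMap.trace ℝ V (R ^ (i + j : ℕ))).det

/-! ### Invariant subspaces of an endomorphism with nonzero discriminant -/

section Algebra

open Polynomial Module

variable {V : Type*} [AddCommGroup V] [Module ℝ V]

/-- If `q(R)` is nilpotent, so is every `R ^ i * q(R)`, and its trace vanishes. The coefficient
vector of `q` then lies in the kernel of the trace matrix, which is trivial. -/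
theorem eq_zero_of_isNilpotent_aeval {N : ℕ} {R : End ℝ V} (hD : traceDiscr N R ≠ 0)
    {q : ℝ[X]} (hq : q.degree < N) (hn : IsNilpotent (aeval R q)) : q = 0 := by
  have key : (fun i : Fin N => q.coeff i) = 0 := by
    refine Matrix.eq_zero_of_mulVec_eq_zero hD ?_
    funext i
    have h1 : LinearMap.trace ℝ V (R ^ (i : ℕ) * aeval R q) = 0 := by
      have hc : Commute (R ^ (i : ℕ)) (aeval R q) := by
        have := (commute_X_pow q (i : ℕ)).symm.map (aeval R)
        simpa using (this.symm)
      exact (LinearMap.isNilpotent_trace_of_isNilpotent (hc.isNilpotent_mul_left hn)).eq_zero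
    rw [aeval_eq_sum_range' (n := N) (by
      by_cases h0 : q = 0
      · subst h0
        simpa using i.pos
      · exact (natDegree_lt_iff_degree_lt h0).2 hq), Finset.mul_sum, map_sum,
      Finset.sum_range] at h1
    simp only [Matrix.mulVec, dotProduct, Matrix.of_apply, Pi.zero_apply]
    rw [← h1]
    refine Finset.sum_congr rfl fun j _ => ?_
    rw [mul_smul_comm, map_smul, smul_eq_mul, pow_add, mul_comm]
  ext m
  by_cases hm : m < N
  · simpa using congrFun key ⟨m, hm⟩
  · rw [coeff_zero]
    exact coeff_eq_zero_of_degree_lt (hq.trans_le (by exact_mod_cast not_lt.1 hm))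

variable {P Q : Submodule ℝ V}

/-- The endomorphism of `Q ≃ V ⧸ P` induced by an endomorphism of `V` that preserves `P`. -/
noncomputable def compression (hQ : IsCompl P Q) (R : End ℝ V) : End ℝ Q :=
  Q.projectionOnto P hQ.symm ∘ₗ R ∘ₗ Q.subtype

theorem projectionOnto_apply_eq_compression (hQ : IsCompl P Q) {R : End ℝ V}
    (hR : ∀ v ∈ P, R v ∈ P) (v : V) :
    Q.projectionOnto P hQ.symm (R v) = compression hQ R (Q.projectionOnto P hQ.symm v) := by
  have h1 := Submodule.projection_add_projection_eq_self hQ v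
  have h2 : Q.projectionOnto P hQ.symm (R (P.projection Q hQ v)) = 0 :=
    (Submodule.projectionOnto_apply_eq_zero_iff hQ.symm).2
      (hR _ (Submodule.projection_apply_mem hQ v))
  conv_lhs => rw [← h1, map_add, map_add, h2, zero_add]
  rfl

theorem projectionOnto_aeval (hQ : IsCompl P Q) {R : End ℝ V}
    (hR : ∀ v ∈ P, R v ∈ P) (q : ℝ[X]) (v : V) :
    Q.projectionOnto P hQ.symm (aeval R q v) =
      aeval (compression hQ R) q (Q.projectionOnto P hQ.symm v) := by
  induction q using Polynomial.induction_on' generalizing v with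
  | add p q hp hq => simp only [map_add, LinearMap.add_apply, hp, hq]
  | monomial m a =>
    simp only [aeval_monomial, End.mul_apply, algebraMap_end_apply, map_smul]
    congr 1
    induction m generalizing v with
    | zero => simp
    | succ m ih =>
      rw [pow_succ, pow_succ, End.mul_apply, End.mul_apply, ih,
        projectionOnto_apply_eq_compression hQ hR]

theorem coe_aeval_restrict {R : End ℝ V} (hR : ∀ v ∈ P, R v ∈ P) (q : ℝ[X]) (v : P) :
    ((aeval (R.restrict hR) q v : P) : V) = aeval R q v := by
  induction q using Polynomial.induction_on' with
  | add p q hp hq => simp only [map_add, LinearMap.add_apply, Submodule.coe_add, hp, hq]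
  | monomial m a =>
    simp only [aeval_monomial, End.mul_apply, algebraMap_end_apply, Submodule.coe_smul]
    congr 1
    induction m generalizing v with
    | zero => simp
    | succ m ih => rw [pow_succ, pow_succ, End.mul_apply, End.mul_apply, ih]; rfl

theorem eq_zero_of_aeval_eq_zero {R : End ℝ V} {a b : ℝ[X]} (hab : IsCoprime a b) {v : V}
    (ha : aeval R a v = 0) (hb : aeval R b v = 0) : v = 0 := by
  obtain ⟨x, y, hxy⟩ := hab
  have h := congrArg (fun q => aeval R q v) hxy
  simpa [ha, hb] using h.symm

variable [FiniteDimensional ℝ V]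

theorem natDegree_minpoly_of_traceDiscr_ne_zero {N : ℕ} {R : End ℝ V}
    (hD : traceDiscr N R ≠ 0) : N ≤ (minpoly ℝ R).natDegree := by
  by_contra! h
  have hne : minpoly ℝ R ≠ 0 := minpoly.ne_zero (Algebra.IsIntegral.isIntegral R)
  refine hne (eq_zero_of_isNilpotent_aeval hD ((natDegree_lt_iff_degree_lt hne).1 h) ?_)
  rw [minpoly.aeval]
  exact IsNilpotent.zero

theorem natDegree_minpoly_le_finrank (R : End ℝ V) :
    (minpoly ℝ R).natDegree ≤ finrank ℝ V := by
  rw [← R.charpoly_natDegree]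
  exact natDegree_le_of_dvd R.minpoly_dvd_charpoly R.charpoly_monic.ne_zero

/-- If `x ^ 2 * h` is the minimal polynomial and `x` is not a unit, then `x * h` has degree below
the dimension, yet its value at `R` squares to zero. -/
theorem squarefree_minpoly_of_traceDiscr_ne_zero {R : End ℝ V}
    (hD : traceDiscr (finrank ℝ V) R ≠ 0) : Squarefree (minpoly ℝ R) := by
  have hne : minpoly ℝ R ≠ 0 := minpoly.ne_zero (Algebra.IsIntegral.isIntegral R)
  rintro x ⟨h, hh⟩
  have hx : x ≠ 0 := by rintro rfl; simp [hne] at hh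
  have hh0 : h ≠ 0 := by rintro rfl; simp [hne] at hh
  by_contra hu
  have hdx : 0 < x.natDegree := by
    rw [Nat.pos_iff_ne_zero]
    intro h0
    exact hu (isUnit_iff_degree_eq_zero.2 (by rw [degree_eq_natDegree hx, h0]; rfl))
  have hdeg : (x * h).natDegree < finrank ℝ V := by
    have h1 := natDegree_minpoly_le_finrank R
    rw [hh, mul_assoc, natDegree_mul hx (mul_ne_zero hx hh0)] at h1
    omega
  refine mul_ne_zero hx hh0 (eq_zero_of_isNilpotent_aeval hD
    ((natDegree_lt_iff_degree_lt (mul_ne_zero hx hh0)).1 hdeg) ⟨2, ?_⟩)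
  rw [← map_pow, show (x * h) ^ 2 = minpoly ℝ R * h by rw [hh]; ring, map_mul, minpoly.aeval,
    zero_mul]

/-- The factor from the quotient sends `V` into `P`, and the factor from `P` kills `P`, so the
product annihilates `R`. Equality follows by degrees: the product has degree at most `dim P + dim Q
= dim V`, and the minimal polynomial of `R` has at least that. -/
theorem minpoly_restrict_mul_minpoly_compression (hQ : IsCompl P Q) {R : End ℝ V}
    (hR : ∀ v ∈ P, R v ∈ P) (hD : traceDiscr (finrank ℝ V) R ≠ 0) :
    minpoly ℝ R = minpoly ℝ (R.restrict hR) * minpoly ℝ (compression hQ R) := by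
  have ha := minpoly.monic (Algebra.IsIntegral.isIntegral (R := ℝ) (R.restrict hR))
  have hb := minpoly.monic (Algebra.IsIntegral.isIntegral (R := ℝ) (compression hQ R))
  refine (eq_of_monic_of_dvd_of_natDegree_le
    (minpoly.monic (Algebra.IsIntegral.isIntegral R)) (ha.mul hb) (minpoly.dvd _ _ ?_) ?_).symm
  · ext v
    have h1 : aeval R (minpoly ℝ (compression hQ R)) v ∈ P := by
      rw [← Submodule.projectionOnto_apply_eq_zero_iff hQ.symm, projectionOnto_aeval hQ hR,
        minpoly.aeval, LinearMap.zero_apply]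
    rw [map_mul, End.mul_apply, LinearMap.zero_apply]
    have h2 := coe_aeval_restrict hR (minpoly ℝ (R.restrict hR)) ⟨_, h1⟩
    rw [minpoly.aeval] at h2
    exact h2.symm
  · have h1 := natDegree_minpoly_le_finrank (R.restrict hR)
    have h2 := natDegree_minpoly_le_finrank (compression hQ R)
    have h3 := natDegree_minpoly_of_traceDiscr_ne_zero hD
    have h4 := Submodule.finrank_add_eq_of_isCompl hQ
    rw [ha.natDegree_mul hb]
    omega

theorem isCoprime_minpoly (hQ : IsCompl P Q) {R : End ℝ V}
    (hR : ∀ v ∈ P, R v ∈ P) (hD : traceDiscr (finrank ℝ V) R ≠ 0) :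
    IsCoprime (minpoly ℝ (R.restrict hR)) (minpoly ℝ (compression hQ R)) := by
  have h := squarefree_minpoly_of_traceDiscr_ne_zero hD
  rw [minpoly_restrict_mul_minpoly_compression hQ hR hD] at h
  exact (squarefree_mul_iff.1 h).1.isCoprime

/-- If the discriminant of `R` is nonzero, there are no nonzero `R`-linear maps `P → V ⧸ P`. -/
theorem eq_zero_of_intertwines (hQ : IsCompl P Q) {R : End ℝ V}
    (hR : ∀ v ∈ P, R v ∈ P) (hD : traceDiscr (finrank ℝ V) R ≠ 0) {f : P →ₗ[ℝ] Q}
    (hf : ∀ v, f (R.restrict hR v) = compression hQ R (f v)) : f = 0 := by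
  have key : ∀ (q : ℝ[X]) v, f (aeval (R.restrict hR) q v) =
      aeval (compression hQ R) q (f v) := by
    intro q v
    induction q using Polynomial.induction_on' with
    | add p q hp hq => simp only [map_add, LinearMap.add_apply, hp, hq]
    | monomial m a =>
      simp only [aeval_monomial, End.mul_apply, algebraMap_end_apply, map_smul]
      congr 1
      induction m generalizing v with
      | zero => simp
      | succ m ih => rw [pow_succ, pow_succ, End.mul_apply, End.mul_apply, ih, hf]
  ext1 v
  refine eq_zero_of_aeval_eq_zero (isCoprime_minpoly hQ hR hD) (R := compression hQ R) ?_ ?_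
  · rw [← key, minpoly.aeval, LinearMap.zero_apply, map_zero]
  · rw [minpoly.aeval, LinearMap.zero_apply]

/-- An endomorphism of nonzero discriminant has only finitely many invariant subspaces. -/
theorem finite_setOf_invariant {R : End ℝ V} (hD : traceDiscr (finrank ℝ V) R ≠ 0) :
    {P : Submodule ℝ V | ∀ v ∈ P, R v ∈ P}.Finite := by
  have hne : minpoly ℝ R ≠ 0 := minpoly.ne_zero (Algebra.IsIntegral.isIntegral R)
  have hfin : {q : ℝ[X] | q.Monic ∧ q ∣ minpoly ℝ R}.Finite := by
    exact @Set.toFinite _ _ (@Finite.of_fintype _ (fintypeSubtypeMonicDvd (minpoly ℝ R) hne))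
  -- `P` is recovered from the minimal polynomial `a` of `R` on `P` as the kernel of `a(R)`. If
  -- `a(R) v = 0`, the class of `v` in `V ⧸ P` is killed both by `a` and by the coprime minimal
  -- polynomial of the quotient, so it is zero.
  refine (hfin.image fun q => LinearMap.ker (aeval R q)).subset ?_
  intro P hR
  obtain ⟨Q, hQ⟩ := P.exists_isCompl
  refine ⟨minpoly ℝ (R.restrict hR), ⟨minpoly.monic (Algebra.IsIntegral.isIntegral _), ?_⟩, ?_⟩
  · rw [minpoly_restrict_mul_minpoly_compression hQ hR hD]
    exact dvd_mul_right _ _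
  · ext v
    simp only [LinearMap.mem_ker]
    constructor
    · intro hv
      rw [← Submodule.projectionOnto_apply_eq_zero_iff hQ.symm]
      refine eq_zero_of_aeval_eq_zero (isCoprime_minpoly hQ hR hD) (R := compression hQ R) ?_ ?_
      · rw [← projectionOnto_aeval hQ hR, hv, map_zero]
      · rw [minpoly.aeval, LinearMap.zero_apply]
    · intro hv
      have h2 := coe_aeval_restrict hR (minpoly ℝ (R.restrict hR)) ⟨v, hv⟩
      rw [minpoly.aeval] at h2
      exact h2.symm

end Algebra

/-! ### Tangent spaces of complex Grassmannians, transversality and finiteness -/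

section Transversality

variable {n k : ℕ}

/-- The discriminant of `J J'`. -/
noncomputable def pairDiscr (p : ComplexStructure n × ComplexStructure n) : ℝ :=
  traceDiscr (2 * n) ((p.1.1 ∘L p.2.1 : RealSpace n →L[ℝ] RealSpace n) :
    RealSpace n →ₗ[ℝ] RealSpace n)

theorem ComplexStructure.apply_apply (J : ComplexStructure n) (v : RealSpace n) :
    J.1 (J.1 v) = -v := by
  have h := congrArg (fun f : RealSpace n →L[ℝ] RealSpace n => f v) J.2
  simpa using h

theorem mem_of_mem_complexGr {J : ComplexStructure n} {P : OrientedGr n k}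
    (hP : P ∈ complexGr k J) : ∀ v ∈ P.plane, J.1 v ∈ P.plane := by
  intro v hv
  have h : J.1 v ∈ P.plane.map (J.1 : RealSpace n →ₗ[ℝ] RealSpace n) := ⟨v, hv, rfl⟩
  rwa [hP.1] at h

theorem map_eq_of_forall_mem {J : ComplexStructure n} {P : Submodule ℝ (RealSpace n)}
    (hP : ∀ v ∈ P, J.1 v ∈ P) : P.map (J.1 : RealSpace n →ₗ[ℝ] RealSpace n) = P := by
  refine le_antisymm ?_ fun v hv => ⟨-J.1 v, P.neg_mem (hP v hv), ?_⟩
  · rintro _ ⟨v, hv, rfl⟩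
    exact hP v hv
  · simp [J.apply_apply]

/-- A `J`-linear map `B : P → V ⧸ P ≃ Q` lifts to a `J`-linear map `P → V`. -/
theorem exists_equivariant_lift (J : ComplexStructure n) {P Q : Submodule ℝ (RealSpace n)}
    (hQ : IsCompl P Q) (hP : ∀ v ∈ P, J.1 v ∈ P) {B : P →ₗ[ℝ] Q}
    (hB : ∀ v : P, B ⟨J.1 v, hP v v.2⟩ = compression hQ (J.1 : Module.End ℝ (RealSpace n)) (B v)) :
    ∃ D : P →ₗ[ℝ] P, ∀ v : P, J.1 ((D v : RealSpace n) + B v) =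
      (D ⟨J.1 v, hP v v.2⟩ : RealSpace n) + B ⟨J.1 v, hP v v.2⟩ := by
  let JP : P →ₗ[ℝ] P := (J.1 : RealSpace n →ₗ[ℝ] RealSpace n).restrict hP
  have hJP : ∀ v : P, JP (JP v) = -v := fun v => Subtype.ext (J.apply_apply v)
  have hB' : ∀ v : P, B (JP v) = compression hQ (J.1 : Module.End ℝ (RealSpace n)) (B v) := hB
  -- The average of `B` over the group generated by `J`: this makes `C` commute with `J`. Modulo `P`
  -- the term `-J B J` equals `B`, so the `Q`-part of `C` is still `B`, and `D` is its `P`-part.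
  let C : P →ₗ[ℝ] RealSpace n := (1 / 2 : ℝ) •
    (Q.subtype ∘ₗ B - (J.1 : RealSpace n →ₗ[ℝ] RealSpace n) ∘ₗ Q.subtype ∘ₗ B ∘ₗ JP)
  have hC : ∀ v, C v = (1 / 2 : ℝ) • ((B v : RealSpace n) - J.1 (B (JP v) : RealSpace n)) :=
    fun v => rfl
  have hCJ : ∀ v, J.1 (C v) = C (JP v) := by
    intro v
    rw [hC, hC, map_smul, map_sub, J.apply_apply, hJP, map_neg, Submodule.coe_neg, map_neg]
    congr 1
    abel
  have hCB : ∀ v, Q.projectionOnto P hQ.symm (C v) = B v := by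
    intro v
    have h1 := projectionOnto_apply_eq_compression hQ
      (R := (J.1 : Module.End ℝ (RealSpace n))) hP (B (JP v) : RealSpace n)
    rw [Submodule.projectionOnto_apply_left, ← hB', hJP, map_neg] at h1
    have h2 : Q.projectionOnto P hQ.symm (J.1 (B (JP v) : RealSpace n)) = -B v := h1
    rw [hC, map_smul, map_sub, h2, Submodule.projectionOnto_apply_left, sub_neg_eq_add,
      ← two_smul ℝ, smul_smul]
    norm_num
  have hCD : ∀ v, ((P.projectionOnto Q hQ (C v) : P) : RealSpace n) + B v = C v := by
    intro v
    rw [← hCB]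
    exact Submodule.projection_add_projection_eq_self hQ (C v)
  refine ⟨P.projectionOnto Q hQ ∘ₗ C, fun v => ?_⟩
  exact (congrArg J.1 (hCD v)).trans ((hCJ v).trans (hCD (JP v)).symm)

/-- The graph may be parametrised by `v ↦ e v + A (e v)` instead of `v ↦ v + A v`. If this
parametrisation is `J`-linear, it carries a basis `(v₁, J v₁, …)` of `P` to one of the same form,
and `det e > 0` ensures that the orientation is that of the chart. -/
theorem graph_mem_complexGr {J : ComplexStructure n} {P : OrientedGr n k}
    (hP : P ∈ complexGr k J) {Q : Submodule ℝ (RealSpace n)} (hQ : IsCompl P.plane Q)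
    (A : P.plane →ₗ[ℝ] Q) (e : P.plane ≃ₗ[ℝ] P.plane)
    (he : 0 < LinearMap.det (e : P.plane →ₗ[ℝ] P.plane))
    (hJ : ∀ v : P.plane, J.1 (P.graphMap Q A (e v)) =
      P.graphMap Q A (e ⟨J.1 v, mem_of_mem_complexGr hP v v.2⟩)) :
    P.graph hQ A ∈ complexGr k J := by
  refine ⟨map_eq_of_forall_mem ?_, ?_⟩
  · rintro _ ⟨v, rfl⟩
    obtain ⟨w, rfl⟩ := e.surjective v
    exact ⟨_, (hJ w).symm⟩
  · obtain ⟨b, hb, ho⟩ := hP.2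
    refine ⟨(b.map e).map (P.graphEquiv hQ A), fun i => ?_, ?_⟩
    · have h1 : (⟨J.1 (b ⟨2 * i, by omega⟩ : RealSpace n),
          mem_of_mem_complexGr hP _ (b ⟨2 * i, by omega⟩).2⟩ : P.plane) =
          b ⟨2 * i + 1, by omega⟩ := Subtype.ext (hb i).symm
      have h2 := hJ (b ⟨2 * i, by omega⟩)
      rw [h1] at h2
      exact h2.symm
    · refine (Module.Basis.orientation_map _ _).trans ?_
      rw [(b.orientation_comp_linearEquiv_eq_iff_det_pos e).2 he, ho]
      rfl

/-- For small `t` the map `1 + t D` is invertible with positive determinant, and inversion is smooth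
on units; `β t` is the inverse. -/
theorem exists_smooth_inverse {E : Type*} [NormedAddCommGroup E] [NormedSpace ℝ E]
    [FiniteDimensional ℝ E] (D : E →ₗ[ℝ] E) :
    ∃ ε > 0, ∃ β : ℝ → (E →ₗ[ℝ] E),
      (∀ v, ContDiffOn ℝ ∞ (fun t => β t v) (Set.Ioo (-ε) ε)) ∧ β 0 = LinearMap.id ∧
      ∀ t ∈ Set.Ioo (-ε) ε, ∃ e : E ≃ₗ[ℝ] E, 0 < LinearMap.det (e : E →ₗ[ℝ] E) ∧
        (∀ v, e v = v + t • D v) ∧ ∀ v, β t (e v) = v := by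
  have : CompleteSpace E := FiniteDimensional.complete ℝ E
  let D' : E →L[ℝ] E := LinearMap.toContinuousLinearMap D
  let α : ℝ → (E →L[ℝ] E) := fun t => 1 + t • D'
  have hα0 : α 0 = 1 := by simp only [α, zero_smul, add_zero]
  have hα : ContDiff ℝ ∞ α := contDiff_const.add (contDiff_id.smul contDiff_const)
  have hu : ∀ᶠ t in 𝓝 (0 : ℝ), IsUnit (α t) := by
    refine hα.continuous.continuousAt.eventually (Units.isOpen.mem_nhds ?_)
    rw [hα0]
    exact isUnit_one
  have hdet : ∀ᶠ t in 𝓝 (0 : ℝ), 0 < (α t).det := by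
    have hc : Continuous fun t => (α t).det := ContinuousLinearMap.continuous_det.comp hα.continuous
    refine hc.continuousAt.eventually (lt_mem_nhds ?_)
    change 0 < (α 0).det
    rw [hα0]
    exact zero_lt_one.trans_eq LinearMap.det_id.symm
  obtain ⟨ε, hε, hball⟩ := Metric.eventually_nhds_iff.1 (hu.and hdet)
  have hball' : ∀ t ∈ Set.Ioo (-ε) ε, IsUnit (α t) ∧ 0 < (α t).det := by
    intro t ht
    exact hball (by rw [Real.dist_eq, sub_zero]; exact abs_lt.2 ht)
  let β : ℝ → (E →L[ℝ] E) := fun t => Ring.inverse (α t)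
  refine ⟨ε, hε, fun t => (β t : E →ₗ[ℝ] E), ?_, ?_, ?_⟩
  · intro v t ht
    obtain ⟨u, hu⟩ := (hball' t ht).1
    have h1 : ContDiffAt ℝ ∞ β t := by
      refine ContDiffAt.comp (g := Ring.inverse) (f := α) t ?_ hα.contDiffAt
      rw [← hu]
      exact contDiffAt_ringInverse ℝ u
    exact (h1.clm_apply contDiffAt_const).contDiffWithinAt
  · have h : β 0 = 1 := by rw [← Ring.inverse_one, ← hα0]
    change (β 0 : E →ₗ[ℝ] E) = LinearMap.id
    rw [h]
    rfl
  · intro t ht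
    obtain ⟨h1, h2⟩ := hball' t ht
    have hl : ∀ v, β t (α t v) = v := fun v =>
      congrArg (fun f : E →L[ℝ] E => f v) (Ring.inverse_mul_cancel _ h1)
    have hr : ∀ v, α t (β t v) = v := fun v =>
      congrArg (fun f : E →L[ℝ] E => f v) (Ring.mul_inverse_cancel _ h1)
    exact ⟨LinearEquiv.ofLinearMap (α t : E →ₗ[ℝ] E) (β t : E →ₗ[ℝ] E)
      (LinearMap.ext hr) (LinearMap.ext hl), h2, fun v => rfl, hl⟩

/-- The straight line `t B` need not stay in the complex Grassmannian. With the `J`-linear lift `D +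
B`, the image of `v ↦ v + t (D v + B v)` is `J`-invariant, and it is the graph of `t B (1 + t D)⁻¹`,
a curve with velocity `B` at `0`. -/
theorem mem_tangentVectors_complexGr {J : ComplexStructure n} {P : OrientedGr n k}
    (hP : P ∈ complexGr k J) {Q : Submodule ℝ (RealSpace n)} (hQ : IsCompl P.plane Q)
    {B : P.plane →ₗ[ℝ] Q}
    (hB : ∀ v : P.plane, B ⟨J.1 v, mem_of_mem_complexGr hP v v.2⟩ =
      compression hQ (J.1 : Module.End ℝ (RealSpace n)) (B v)) :
    B ∈ OrientedGr.tangentVectors (complexGr k J) P hQ := by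
  obtain ⟨D, hD⟩ := exists_equivariant_lift J hQ (mem_of_mem_complexGr hP) hB
  obtain ⟨ε, hε, β, hβ, hβ0, hβe⟩ := exists_smooth_inverse D
  have hsmooth : ∀ v : P.plane, ContDiffOn ℝ ∞ (fun t => B (β t v)) (Set.Ioo (-ε) ε) :=
    fun v => (LinearMap.toContinuousLinearMap B).contDiff.comp_contDiffOn (hβ v)
  refine ⟨ε, hε, fun t => t • B ∘ₗ β t, ?_, ?_, ?_, ?_⟩
  · exact fun v => contDiffOn_id.smul (hsmooth v)
  · intro t ht
    obtain ⟨e, hdet, he, hinv⟩ := hβe t ht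
    have hmap : ∀ v : P.plane, P.graphMap Q (t • B ∘ₗ β t) (e v) =
        (v : RealSpace n) + t • ((D v : RealSpace n) + B v) := by
      intro v
      have h3 : P.graphMap Q (t • B ∘ₗ β t) (e v) =
        (e v : RealSpace n) + t • (B (β t (e v)) : RealSpace n) := rfl
      rw [h3, hinv, he, Submodule.coe_add, Submodule.coe_smul, smul_add, add_assoc]
    refine graph_mem_complexGr hP hQ _ e hdet fun v => ?_
    rw [hmap, hmap, map_add, map_smul, hD]
  · exact zero_smul ℝ _
  · intro v
    have h2 := (((hsmooth v).contDiffAt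
      (Ioo_mem_nhds (neg_lt_zero.2 hε) hε)).differentiableAt (by simp)).hasDerivAt
    have h3 := (hasDerivAt_id (0 : ℝ)).smul h2
    have h4 : B (β 0 v) = B v := by rw [hβ0]; rfl
    simp only [id, zero_smul, one_smul, zero_add, h4] at h3
    exact h3

/-- In the charts `Hom(P, Q)` at `P` and at its reversal, `τ` is the identity, so tangent vectors
carry over unchanged. -/
theorem OrientedGr.graph_tau (P : OrientedGr n k) {Q : Submodule ℝ (RealSpace n)}
    (hQ : IsCompl P.plane Q) (A : P.plane →ₗ[ℝ] Q) :
    (tau P).graph hQ A = tau (P.graph hQ A) := by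
  have h := Orientation.map_neg (P.graphEquiv hQ A) P.orientation
  exact congrArg (OrientedGr.mk (LinearMap.range (P.graphMap Q A))
    ((P.graphEquiv hQ A).finrank_eq.symm.trans P.finrank_plane)) h

theorem OrientedGr.tangentVectors_subset_tau (S : Set (OrientedGr n k)) (P : OrientedGr n k)
    {Q : Submodule ℝ (RealSpace n)} (hQ : IsCompl P.plane Q) :
    tangentVectors S P hQ ⊆ tangentVectors (tau '' S) (tau P) hQ := by
  rintro B ⟨ε, hε, γ, h1, h2, h3, h4⟩
  exact ⟨ε, hε, γ, h1, fun t ht => ⟨_, h2 t ht, (P.graph_tau hQ (γ t)).symm⟩, h3, h4⟩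

/-- If `J J'` has nonzero discriminant and `P` is `J`- and `J'`-invariant, then each linear map
`P → V ⧸ P` is the sum of a `J`-linear map and a `J'`-linear map. -/
theorem exists_add_of_pairDiscr_ne_zero {J J' : ComplexStructure n}
    (hD : pairDiscr (J, J') ≠ 0)
    {P Q : Submodule ℝ (RealSpace n)} (hQ : IsCompl P Q)
    (hP : ∀ v ∈ P, J.1 v ∈ P) (hP' : ∀ v ∈ P, J'.1 v ∈ P) (B : P →ₗ[ℝ] Q) :
    ∃ B₁ B₂ : P →ₗ[ℝ] Q, B = B₁ + B₂ ∧
      (∀ v : P, B₁ ⟨J.1 v, hP v v.2⟩ =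
        compression hQ (J.1 : Module.End ℝ (RealSpace n)) (B₁ v)) ∧
      ∀ v : P, B₂ ⟨J'.1 v, hP' v v.2⟩ =
        compression hQ (J'.1 : Module.End ℝ (RealSpace n)) (B₂ v) := by
  have hQJ : ∀ (I : ComplexStructure n), (∀ v ∈ P, I.1 v ∈ P) → ∀ w : Q,
      compression hQ (I.1 : Module.End ℝ (RealSpace n))
        (compression hQ (I.1 : Module.End ℝ (RealSpace n)) w) = -w := by
    intro I hI w
    have h1 := projectionOnto_apply_eq_compression hQ
      (R := (I.1 : Module.End ℝ (RealSpace n))) hI (I.1 w)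
    refine h1.symm.trans ?_
    change Q.projectionOnto P hQ.symm (I.1 (I.1 w)) = -w
    rw [I.apply_apply, map_neg, Submodule.projectionOnto_apply_left]
  set K : Module.End ℝ Q := compression hQ (J.1 : Module.End ℝ (RealSpace n)) with hK
  set K' : Module.End ℝ Q := compression hQ (J'.1 : Module.End ℝ (RealSpace n)) with hK'
  have hKK : ∀ w, K (K w) = -w := hQJ J hP
  have hKK' : ∀ w, K' (K' w) = -w := hQJ J' hP'
  let L : P →ₗ[ℝ] P := (J.1 : RealSpace n →ₗ[ℝ] RealSpace n).restrict hP
  let L' : P →ₗ[ℝ] P := (J'.1 : RealSpace n →ₗ[ℝ] RealSpace n).restrict hP'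
  have hLL : ∀ v, L (L v) = -v := fun v => Subtype.ext (J.apply_apply v)
  have hLL' : ∀ v, L' (L' v) = -v := fun v => Subtype.ext (J'.apply_apply v)
  -- Since `K` and `L` square to `-1`, this is an involution, and its fixed points are the
  -- `J`-linear maps.
  let σ : (P →ₗ[ℝ] Q) →ₗ[ℝ] (P →ₗ[ℝ] Q) := -(LinearMap.compRight ℝ K ∘ₗ LinearMap.lcomp ℝ Q L)
  let σ' : (P →ₗ[ℝ] Q) →ₗ[ℝ] (P →ₗ[ℝ] Q) := -(LinearMap.compRight ℝ K' ∘ₗ LinearMap.lcomp ℝ Q L')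
  have hσ : ∀ C v, σ C v = -K (C (L v)) := fun C v => rfl
  have hσ' : ∀ C v, σ' C v = -K' (C (L' v)) := fun C v => rfl
  let R : Module.End ℝ (RealSpace n) :=
    ((J.1 ∘L J'.1 : RealSpace n →L[ℝ] RealSpace n) : RealSpace n →ₗ[ℝ] RealSpace n)
  have hR : ∀ v ∈ P, R v ∈ P :=
    fun v hv => hP _ (hP' v hv)
  have hcomp : ∀ w, compression hQ R w = K (K' w) :=
    fun w => projectionOnto_apply_eq_compression hQ
      (R := (J.1 : Module.End ℝ (RealSpace n))) hP (J'.1 w)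
  have hinj : Function.Injective (LinearMap.id - σ ∘ₗ σ' : (P →ₗ[ℝ] Q) →ₗ[ℝ] (P →ₗ[ℝ] Q)) := by
    rw [← LinearMap.ker_eq_bot, LinearMap.ker_eq_bot']
    intro C hC
    refine eq_zero_of_intertwines hQ hR (by rw [finrank_euclideanSpace_fin]; exact hD) fun v => ?_
    have h1 : C (R.restrict hR v) = C (L (L' v)) := rfl
    -- `σ (σ' C) = K K' C L' L`, and `L' L` is the inverse of `L L'`; evaluating at `L (L' v)` thus
    -- gives `C (L L' v) = K K' C v`.
    have h2 := congrArg (fun f : P →ₗ[ℝ] Q => f (L (L' v))) hC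
    simp only [LinearMap.sub_apply, LinearMap.id_apply, LinearMap.comp_apply,
      LinearMap.zero_apply, hσ, hσ', hLL, hLL', map_neg, neg_neg] at h2
    rw [h1, hcomp]
    exact sub_eq_zero.1 h2
  obtain ⟨C, hC⟩ := (LinearMap.injective_iff_surjective.1 hinj) B
  -- Sums of the form `x + σ x` are fixed by `σ`, and those of the form `x + σ' x` by `σ'`.
  refine ⟨-(σ' C + σ (σ' C)), C + σ' C, ?_, fun v => ?_, fun v => ?_⟩
  · rw [← hC]
    simp only [LinearMap.sub_apply, LinearMap.id_apply, LinearMap.comp_apply]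
    abel
  · change (-(σ' C + σ (σ' C))) (L v) = K _
    simp only [LinearMap.neg_apply, LinearMap.add_apply, hσ (σ' C), hLL, map_neg, map_add, hKK]
    abel
  · change (C + σ' C) (L' v) = K' _
    simp only [LinearMap.add_apply, hσ', hLL', map_neg, map_add, hKK', neg_neg]
    abel

theorem finite_orientedGr_of_finite_plane {S : Set (OrientedGr n k)}
    {F : Set (Submodule ℝ (RealSpace n))} (hF : F.Finite) (hS : ∀ P ∈ S, P.plane ∈ F) :
    S.Finite := by
  refine (hF.preimage' (f := OrientedGr.plane) fun p _ => ?_).subset hS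
  by_cases h : ∃ P : OrientedGr n k, P.plane = p
  · obtain ⟨P, rfl⟩ := h
    refine (Set.toFinite {P, OrientedGr.tau P}).subset ?_
    rintro ⟨p, hp, o⟩ rfl
    rcases o.eq_or_eq_neg P.orientation (by simpa using hp.symm) with h | h
    · left
      subst h
      rfl
    · right
      subst h
      rfl
  · convert Set.finite_empty
    ext P
    simp only [Set.mem_preimage, Set.mem_singleton_iff, Set.mem_empty_iff_false, iff_false]
    exact fun hP => h ⟨P, hP⟩

theorem intersectTransversally_of_pairDiscr_ne_zero {J J' : ComplexStructure n}
    (hD : pairDiscr (J, J') ≠ 0) :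
    OrientedGr.IntersectTransversally (complexGr k J) (complexGr k J') := by
  rintro P ⟨hP, hP'⟩ Q hQ B
  obtain ⟨B₁, B₂, h, h₁, h₂⟩ := exists_add_of_pairDiscr_ne_zero hD hQ
    (mem_of_mem_complexGr hP) (mem_of_mem_complexGr hP') B
  exact ⟨B₁, mem_tangentVectors_complexGr hP hQ h₁, B₂, mem_tangentVectors_complexGr hP' hQ h₂, h⟩

theorem intersectTransversally_tau_of_pairDiscr_ne_zero {J J' : ComplexStructure n}
    (hD : pairDiscr (J, J') ≠ 0) :
    OrientedGr.IntersectTransversally (complexGr k J) (OrientedGr.tau '' complexGr k J') := by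
  rintro _ ⟨hP, P, hP', rfl⟩ Q hQ B
  obtain ⟨B₁, B₂, h, h₁, h₂⟩ := exists_add_of_pairDiscr_ne_zero hD hQ
    (mem_of_mem_complexGr hP) (mem_of_mem_complexGr (P := P) hP') B
  exact ⟨B₁, mem_tangentVectors_complexGr hP hQ h₁, B₂,
    OrientedGr.tangentVectors_subset_tau _ P hQ (mem_tangentVectors_complexGr hP' hQ h₂), h⟩

theorem finite_inter_of_pairDiscr_ne_zero {J J' : ComplexStructure n}
    (hD : pairDiscr (J, J') ≠ 0) :
    (complexGr k J ∩ complexGr k J').Finite := by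
  refine finite_orientedGr_of_finite_plane
    (finite_setOf_invariant (by rw [finrank_euclideanSpace_fin]; exact hD)) ?_
  rintro P ⟨hP, hP'⟩ v hv
  exact mem_of_mem_complexGr hP _ (mem_of_mem_complexGr hP' v hv)

theorem finite_inter_tau_of_pairDiscr_ne_zero {J J' : ComplexStructure n}
    (hD : pairDiscr (J, J') ≠ 0) :
    (complexGr k J ∩ OrientedGr.tau '' complexGr k J').Finite := by
  refine finite_orientedGr_of_finite_plane
    (finite_setOf_invariant (by rw [finrank_euclideanSpace_fin]; exact hD)) ?_
  rintro _ ⟨hP, P, hP', rfl⟩ v hv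
  exact mem_of_mem_complexGr hP _ (mem_of_mem_complexGr (P := P) hP' v hv)

end Transversality

/-! ### The discriminant is nonzero for a generic pair -/

section Genericity

open Polynomial Module

/-- The traces are power sums of the eigenvalues, so the trace matrix is `Wᵀ W` with `W` the
Vandermonde matrix. -/
theorem traceDiscr_ne_zero_of_eigenbasis {V : Type*} [AddCommGroup V] [Module ℝ V] {N : ℕ}
    {R : End ℝ V} (b : Basis (Fin N) ℝ V) {μ : Fin N → ℝ} (hμ : Function.Injective μ)
    (hR : ∀ i, R (b i) = μ i • b i) : traceDiscr N R ≠ 0 := by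
  have hpow : ∀ (m : ℕ) i, (R ^ m) (b i) = μ i ^ m • b i := by
    intro m i
    induction m with
    | zero => simp
    | succ m ih => rw [pow_succ, End.mul_apply, hR, map_smul, ih, smul_smul, pow_succ, mul_comm]
  have htr : ∀ m : ℕ, LinearMap.trace ℝ V (R ^ m) = ∑ i, μ i ^ m := by
    intro m
    rw [LinearMap.trace_eq_matrix_trace ℝ b, Matrix.trace]
    refine Finset.sum_congr rfl fun i _ => ?_
    simp [LinearMap.toMatrix_apply, hpow]
  have h : (Matrix.of fun i j : Fin N => LinearMap.trace ℝ V (R ^ (i + j : ℕ))) =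
      (Matrix.vandermonde μ).transpose * Matrix.vandermonde μ := by
    ext i j
    rw [Matrix.of_apply, htr]
    simp [Matrix.mul_apply, Matrix.vandermonde_apply, pow_add]
  rw [traceDiscr, h, Matrix.det_mul, Matrix.det_transpose]
  exact mul_self_ne_zero.2 (Matrix.det_vandermonde_ne_zero_iff.2 hμ)

/-- A complex structure has a real basis of the form `(v₁, …, v_n, J v₁, …, J v_n)`. -/
theorem exists_basis_of_complexStructure {E : Type*} [AddCommGroup E] [Module ℝ E]
    [FiniteDimensional ℝ E] {n : ℕ} (hn : finrank ℝ E = 2 * n) (J : End ℝ E) (hJ : J * J = -1) :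
    ∃ b : Basis (Fin 2 × Fin n) ℝ E, ∀ i, J (b (0, i)) = b (1, i) := by
  -- `J` makes the space a complex vector space of dimension `n`; the real basis comes from a
  -- complex one and `(1, i)`.
  let φ : ℂ →ₐ[ℝ] End ℝ E := Complex.liftAux J hJ
  let _ : Module ℂ E := Module.compHom E φ.toRingHom
  have hsmul : ∀ (z : ℂ) (v : E), z • v = φ z v := fun z v => rfl
  have : IsScalarTower ℝ ℂ E := ⟨fun r z v => by rw [hsmul, hsmul, map_smul]; rfl⟩
  have : Module.Finite ℂ E := Module.Finite.of_restrictScalars_finite ℝ ℂ E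
  have hrank : finrank ℂ E = n := by
    have h := Module.finrank_mul_finrank ℝ ℂ E
    rw [Complex.finrank_real_complex] at h
    omega
  let c := Module.finBasisOfFinrankEq ℂ E hrank
  refine ⟨Complex.basisOneI.smulTower c, fun i => ?_⟩
  rw [Basis.smulTower_apply, Basis.smulTower_apply, hsmul, hsmul]
  simp [φ, Complex.liftAux_apply]

/-- `J J'` is conjugate to its inverse `J' J`, so eigenvalues come in pairs `λ, λ⁻¹`. Here `e`
matches adapted bases of `J'` and `J` after stretching the vectors `b (1, i)` by `s`, which gives
eigenvalues `-s` and `-s⁻¹`. -/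
theorem exists_conj_traceDiscr_ne_zero {E : Type*} [AddCommGroup E] [Module ℝ E]
    [FiniteDimensional ℝ E] {n : ℕ} (hn : finrank ℝ E = 2 * n) {J J' : End ℝ E}
    (hJ : J * J = -1) (hJ' : J' * J' = -1) :
    ∃ e : E ≃ₗ[ℝ] E, traceDiscr (2 * n)
      (J * ((e : E →ₗ[ℝ] E) ∘ₗ J' ∘ₗ (e.symm : E →ₗ[ℝ] E))) ≠ 0 := by
  obtain ⟨b, hb⟩ := exists_basis_of_complexStructure hn J hJ
  obtain ⟨b', hb'⟩ := exists_basis_of_complexStructure hn J' hJ'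
  have neg_of {K : End ℝ E} (hK : K * K = -1) (v : E) : K (K v) = -v :=
    congrArg (fun f : End ℝ E => f v) hK
  have hb1 : ∀ i, J (b (1, i)) = -b (0, i) := fun i => by rw [← hb, neg_of hJ]
  have hb1' : ∀ i, J' (b' (1, i)) = -b' (0, i) := fun i => by rw [← hb', neg_of hJ']
  have hs : ∀ i : Fin n, ((i : ℝ) + 2) ≠ 0 := fun i => by positivity
  -- The factors `s = i + 2` are distinct and exceed `1`, so no `s` equals the inverse of another or
  -- of itself.
  let w : Fin 2 × Fin n → ℝˣ := fun x => if x.1 = 0 then 1 else Units.mk0 _ (hs x.2)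
  let e : E ≃ₗ[ℝ] E := b'.equiv (b.unitsSMul w) (Equiv.refl _)
  have he0 : ∀ i, e (b' (0, i)) = b (0, i) := fun i => by
    simp [e, w, Basis.unitsSMul_apply]
  have he1 : ∀ i : Fin n, e (b' (1, i)) = ((i : ℝ) + 2) • b (1, i) := fun i => by
    simp [e, w, Basis.unitsSMul_apply, Units.smul_def]
  have he1' : ∀ i : Fin n, e.symm (b (1, i)) = ((i : ℝ) + 2)⁻¹ • b' (1, i) := fun i => by
    rw [LinearEquiv.symm_apply_eq, map_smul, he1, smul_smul, inv_mul_cancel₀ (hs i), one_smul]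
  let μ : Fin 2 × Fin n → ℝ := fun x => if x.1 = 0 then -((x.2 : ℝ) + 2) else -((x.2 : ℝ) + 2)⁻¹
  have hμ : Function.Injective μ := by
    have hlt : ∀ i j : Fin n, ((j : ℝ) + 2)⁻¹ < (i : ℝ) + 2 := by
      intro i j
      have h1 : ((j : ℝ) + 2)⁻¹ < 1 := inv_lt_one_of_one_lt₀ (by
        have : (0 : ℝ) ≤ (j : ℝ) := by positivity
        linarith)
      have h2 : (0 : ℝ) ≤ (i : ℝ) := by positivity
      linarith
    rintro ⟨x, i⟩ ⟨y, j⟩ hxy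
    fin_cases x <;> fin_cases y <;> simp [μ] at hxy ⊢
    · exact Fin.ext hxy
    · linarith [hlt i j]
    · linarith [hlt j i]
    · exact Fin.ext hxy
  let ε : Fin 2 × Fin n ≃ Fin (2 * n) := finProdFinEquiv
  refine ⟨e, traceDiscr_ne_zero_of_eigenbasis (b.reindex ε) (hμ.comp ε.symm.injective) fun i => ?_⟩
  obtain ⟨⟨x, i⟩, rfl⟩ := ε.surjective i
  simp only [Basis.reindex_apply, Equiv.symm_apply_apply, Function.comp_apply, End.mul_apply,
    LinearMap.comp_apply, LinearEquiv.coe_coe]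
  obtain rfl | rfl : x = 0 ∨ x = 1 := by omega
  · rw [← he0, LinearEquiv.symm_apply_apply, hb', he1, he0, map_smul, hb1, smul_neg, ← neg_smul]
    rfl
  · rw [he1', map_smul, map_smul, map_smul, hb1', map_neg, he0, map_neg, hb]
    simp [μ]

/-- The discriminant of a matrix: the determinant of the matrix of the traces of `M ^ (i + j)`. -/
noncomputable def Matrix.traceDiscr {A : Type*} [CommRing A] {N : ℕ}
    (M : Matrix (Fin N) (Fin N) A) : A :=
  (Matrix.of fun i j : Fin N => (M ^ (i + j : ℕ)).trace).det

theorem Matrix.map_traceDiscr {A B : Type*} [CommRing A] [CommRing B] {N : ℕ} (f : A →+* B)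
    (M : Matrix (Fin N) (Fin N) A) : f M.traceDiscr = (f.mapMatrix M).traceDiscr := by
  rw [Matrix.traceDiscr, RingHom.map_det, Matrix.traceDiscr]
  congr 1
  ext i j
  simp only [RingHom.mapMatrix_apply, Matrix.map_apply, Matrix.of_apply]
  rw [← RingHom.mapMatrix_apply, ← map_pow, RingHom.mapMatrix_apply, AddMonoidHom.map_trace f]

/-- Entry `(i, j)` of the trace matrix scales by `c ^ i * c ^ j`. This permits passing between the
inverse and the adjugate in conjugations. -/
theorem Matrix.traceDiscr_smul {A : Type*} [CommRing A] {N : ℕ} (c : A)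
    (M : Matrix (Fin N) (Fin N) A) (h : M.traceDiscr = 0) : (c • M).traceDiscr = 0 := by
  have h1 : (Matrix.of fun i j : Fin N => ((c • M) ^ (i + j : ℕ)).trace) =
      Matrix.diagonal (fun i : Fin N => c ^ (i : ℕ)) *
        (Matrix.of fun i j : Fin N => (M ^ (i + j : ℕ)).trace) *
        Matrix.diagonal (fun i : Fin N => c ^ (i : ℕ)) := by
    ext i j
    rw [Matrix.mul_diagonal, Matrix.diagonal_mul, Matrix.of_apply, Matrix.of_apply, _root_.smul_pow,
      Matrix.trace_smul, smul_eq_mul, pow_add]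
    ring
  have h2 : (Matrix.of fun i j : Fin N => (M ^ (i + j : ℕ)).trace).det = 0 := h
  rw [Matrix.traceDiscr, h1, Matrix.det_mul, Matrix.det_mul, h2, mul_zero, zero_mul]

theorem Matrix.traceDiscr_conj_eventually_ne_zero {N : ℕ} {A A' G : Matrix (Fin N) (Fin N) ℝ}
    (h : (A * (G * A' * G⁻¹)).traceDiscr ≠ 0) :
    ∀ᶠ t in 𝓝[≠] (0 : ℝ),
      (A * ((1 + t • (G - 1)) * A' * (1 + t • (G - 1))⁻¹)).traceDiscr ≠ 0 := by
  let F : Matrix (Fin N) (Fin N) ℝ[X] := 1 + (X : ℝ[X]) • (C : ℝ →+* ℝ[X]).mapMatrix (G - 1)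
  -- The adjugate replaces the inverse so that the entries are polynomials in `t`; the two differ by
  -- a scalar.
  let p : ℝ[X] := ((C : ℝ →+* ℝ[X]).mapMatrix A *
    (F * (C : ℝ →+* ℝ[X]).mapMatrix A' * F.adjugate)).traceDiscr
  have hC : ∀ t (M : Matrix (Fin N) (Fin N) ℝ),
      (evalRingHom t).mapMatrix ((C : ℝ →+* ℝ[X]).mapMatrix M) = M := by
    intro t M
    ext i j
    simp
  have hF : ∀ t, (evalRingHom t).mapMatrix F = 1 + t • (G - 1) := by
    intro t
    ext i j
    by_cases hij : i = j
    · simp [F, hij]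
    · simp [F, hij, mul_comm t]
  have hp : ∀ t, p.eval t =
      (A * ((1 + t • (G - 1)) * A' * (1 + t • (G - 1)).adjugate)).traceDiscr := by
    intro t
    have h1 := Matrix.map_traceDiscr (evalRingHom t) ((C : ℝ →+* ℝ[X]).mapMatrix A *
      (F * (C : ℝ →+* ℝ[X]).mapMatrix A' * F.adjugate))
    rw [map_mul, map_mul, map_mul, RingHom.map_adjugate, hC, hC, hF] at h1
    exact h1
  have hadj : ∀ M : Matrix (Fin N) (Fin N) ℝ,
      A * (M * A' * M⁻¹) = Ring.inverse M.det • (A * (M * A' * M.adjugate)) := by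
    intro M
    rw [Matrix.inv_def, Matrix.mul_smul, Matrix.mul_smul]
  have hadj' : ∀ M : Matrix (Fin N) (Fin N) ℝ, IsUnit M.det →
      A * (M * A' * M.adjugate) = M.det • (A * (M * A' * M⁻¹)) := by
    intro M hM
    rw [hadj, smul_smul, Ring.mul_inverse_cancel _ hM, one_smul]
  have hp0 : p ≠ 0 := by
    intro h0
    have h1 := hp 1
    rw [h0, eval_zero, one_smul, add_sub_cancel] at h1
    refine h ?_
    rw [hadj]
    exact Matrix.traceDiscr_smul _ _ h1.symm
  have hroots : ∀ᶠ t in 𝓝[≠] (0 : ℝ), p.eval t ≠ 0 := by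
    have hfin : {t | p.IsRoot t}.Finite := p.finite_setOfPred_isRoot hp0
    -- The point `0` may itself be a root, namely when the given pair has zero discriminant.
    have hcl : IsClosed ({t | p.IsRoot t} \ {0}) := (hfin.subset Set.sdiff_subset).isClosed
    have h1 := hcl.isOpen_compl.mem_nhds (x := (0 : ℝ)) (by simp)
    filter_upwards [mem_nhdsWithin_of_mem_nhds h1, self_mem_nhdsWithin] with t ht ht0 hr
    exact ht ⟨hr, ht0⟩
  have hdet : ∀ᶠ t in 𝓝 (0 : ℝ), (1 + t • (G - 1)).det ≠ 0 := by
    have hc : Continuous fun t : ℝ => (1 + t • (G - 1)).det := by fun_prop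
    refine hc.continuousAt.eventually_ne ?_
    simp
  filter_upwards [hroots, mem_nhdsWithin_of_mem_nhds hdet] with t ht hd h0
  refine ht ?_
  rw [hp, hadj' _ (isUnit_iff_ne_zero.2 hd)]
  exact Matrix.traceDiscr_smul _ _ h0

/-! ### Openness and density in the space of pairs -/

theorem traceDiscr_eq_toMatrix {V : Type*} [AddCommGroup V] [Module ℝ V] {N : ℕ}
    (b : Basis (Fin N) ℝ V) (R : End ℝ V) :
    traceDiscr N R = (LinearMap.toMatrix b b R).traceDiscr := by
  rw [traceDiscr, Matrix.traceDiscr]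
  congr 1
  ext i j
  rw [Matrix.of_apply, Matrix.of_apply, LinearMap.trace_eq_matrix_trace ℝ b,
    ← LinearMap.toMatrix_pow]

/-- The standard basis of `ℝ^{2n}`. -/
noncomputable def stdBasis (n : ℕ) : Basis (Fin (2 * n)) ℝ (RealSpace n) :=
  (EuclideanSpace.basisFun (Fin (2 * n)) ℝ).toBasis

/-- The matrix of an endomorphism of `ℝ^{2n}` in the standard basis. -/
noncomputable def matrixEquiv (n : ℕ) : (RealSpace n →L[ℝ] RealSpace n) ≃ₗ[ℝ]
    Matrix (Fin (2 * n)) (Fin (2 * n)) ℝ :=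
  LinearMap.toContinuousLinearMap.symm.trans (LinearMap.toMatrix (stdBasis n) (stdBasis n))

theorem matrixEquiv_comp {n : ℕ} (f g : RealSpace n →L[ℝ] RealSpace n) :
    matrixEquiv n (f ∘L g) = matrixEquiv n f * matrixEquiv n g :=
  LinearMap.toMatrix_comp (stdBasis n) (stdBasis n) (stdBasis n) _ _

theorem matrixEquiv_id (n : ℕ) : matrixEquiv n (ContinuousLinearMap.id ℝ (RealSpace n)) = 1 :=
  LinearMap.toMatrix_id (stdBasis n)

theorem matrixEquiv_mul_self {n : ℕ} (J : ComplexStructure n) :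
    matrixEquiv n J.1 * matrixEquiv n J.1 = -1 := by
  rw [← matrixEquiv_comp, J.2, map_neg, matrixEquiv_id]

theorem matrixEquiv_symm_comp_self {n : ℕ} {M : Matrix (Fin (2 * n)) (Fin (2 * n)) ℝ}
    (hM : M * M = -1) :
    (matrixEquiv n).symm M ∘L (matrixEquiv n).symm M =
      -ContinuousLinearMap.id ℝ (RealSpace n) := by
  apply (matrixEquiv n).injective
  rw [matrixEquiv_comp, LinearEquiv.apply_symm_apply, hM, map_neg, matrixEquiv_id]

theorem pairDiscr_eq {n : ℕ} (p : ComplexStructure n × ComplexStructure n) :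
    pairDiscr p = (matrixEquiv n p.1.1 * matrixEquiv n p.2.1).traceDiscr := by
  rw [pairDiscr, traceDiscr_eq_toMatrix (stdBasis n), ← matrixEquiv_comp]
  rfl

theorem continuous_pairDiscr (n : ℕ) : Continuous (pairDiscr (n := n)) := by
  have h : Continuous (matrixEquiv n) :=
    LinearMap.continuous_of_finiteDimensional (matrixEquiv n).toLinearMap
  have h1 : Continuous fun p : ComplexStructure n × ComplexStructure n =>
      matrixEquiv n p.1.1 * matrixEquiv n p.2.1 :=
    (h.comp (continuous_subtype_val.comp continuous_fst)).mul
      (h.comp (continuous_subtype_val.comp continuous_snd))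
  have h2 : Continuous fun M : Matrix (Fin (2 * n)) (Fin (2 * n)) ℝ => M.traceDiscr :=
    Continuous.matrix_det (continuous_matrix fun i j => (continuous_pow _).matrix_trace)
  rw [show pairDiscr (n := n) = _ from funext pairDiscr_eq]
  exact h2.comp h1

theorem exists_conj_matrix_traceDiscr_ne_zero {n : ℕ} (J J' : ComplexStructure n) :
    ∃ G : Matrix (Fin (2 * n)) (Fin (2 * n)) ℝ,
      (matrixEquiv n J.1 * (G * matrixEquiv n J'.1 * G⁻¹)).traceDiscr ≠ 0 := by
  have hsq : ∀ I : ComplexStructure n, (I.1 : End ℝ (RealSpace n)) * (I.1 : End ℝ (RealSpace n)) =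
      -1 := fun I => LinearMap.ext I.apply_apply
  obtain ⟨e, he⟩ := exists_conj_traceDiscr_ne_zero (n := n) finrank_euclideanSpace_fin
    (hsq J) (hsq J')
  set b := stdBasis n with hb
  have hinv : LinearMap.toMatrix b b (e : RealSpace n →ₗ[ℝ] RealSpace n) *
      LinearMap.toMatrix b b (e.symm : RealSpace n →ₗ[ℝ] RealSpace n) = 1 := by
    rw [← LinearMap.toMatrix_comp, LinearEquiv.comp_symm, LinearMap.toMatrix_id]
  refine ⟨LinearMap.toMatrix b b (e : RealSpace n →ₗ[ℝ] RealSpace n), ?_⟩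
  rw [Matrix.inv_eq_right_inv hinv]
  rw [traceDiscr_eq_toMatrix b, LinearMap.toMatrix_mul, LinearMap.toMatrix_comp b b b,
    LinearMap.toMatrix_comp b b b, ← mul_assoc (LinearMap.toMatrix b b (e : _ →ₗ[ℝ] _))] at he
  exact he

theorem dense_setOf_pairDiscr_ne_zero (n : ℕ) :
    Dense {p : ComplexStructure n × ComplexStructure n | pairDiscr p ≠ 0} := by
  rintro ⟨J, J'⟩
  obtain ⟨G, hGJ⟩ := exists_conj_matrix_traceDiscr_ne_zero J J'
  let g : ℝ → Matrix (Fin (2 * n)) (Fin (2 * n)) ℝ := fun t => 1 + t • (G - 1)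
  have hg0 : g 0 = 1 := by simp [g]
  have hgc : Continuous g := by fun_prop
  let M : ℝ → Matrix (Fin (2 * n)) (Fin (2 * n)) ℝ := fun t => g t * matrixEquiv n J'.1 * (g t)⁻¹
  have hdet : ∀ᶠ t in 𝓝[≠] (0 : ℝ), IsUnit (g t).det := by
    refine mem_nhdsWithin_of_mem_nhds ?_
    have h := hgc.matrix_det.continuousAt.eventually_ne (x := 0) (y := 0) (by simp [hg0])
    exact h.mono fun t ht => isUnit_iff_ne_zero.2 ht
  have hM : ∀ t, IsUnit (g t).det → M t * M t = -1 := by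
    intro t ht
    change g t * matrixEquiv n J'.1 * (g t)⁻¹ * (g t * matrixEquiv n J'.1 * (g t)⁻¹) = -1
    rw [mul_assoc, mul_assoc, mul_assoc, ← mul_assoc (g t)⁻¹, Matrix.nonsing_inv_mul _ ht,
      one_mul, ← mul_assoc (matrixEquiv n J'.1), matrixEquiv_mul_self, neg_one_mul, mul_neg,
      Matrix.mul_nonsing_inv _ ht]
  have hMc : Filter.Tendsto M (𝓝[≠] 0) (𝓝 (matrixEquiv n J'.1)) := by
    have hinv : ContinuousAt (fun t => (g t)⁻¹) 0 := by
      have h : ContinuousAt (fun t => ((g t).det)⁻¹ • (g t).adjugate) 0 :=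
        (hgc.matrix_det.continuousAt.inv₀ (by simp [hg0])).smul hgc.matrix_adjugate.continuousAt
      refine h.congr (Filter.Eventually.of_forall fun t => ?_)
      change ((g t).det)⁻¹ • (g t).adjugate = (g t)⁻¹
      rw [Matrix.inv_def, Ring.inverse_eq_inv']
    have h : ContinuousAt M 0 := (hgc.continuousAt.mul continuousAt_const).mul hinv
    have h0 : M 0 = matrixEquiv n J'.1 := by simp [M, hg0]
    rw [← h0]
    exact h.tendsto.mono_left nhdsWithin_le_nhds
  classical
  -- Only `J'` is moved. The default `J'` is taken where `g t` is singular, which does not happen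
  -- for `t` near `0`.
  let f : ℝ → ComplexStructure n := fun t =>
    if h : IsUnit (g t).det then ⟨_, matrixEquiv_symm_comp_self (hM t h)⟩ else J'
  have hf : ∀ t, IsUnit (g t).det → (f t).1 = (matrixEquiv n).symm (M t) := by
    intro t ht
    simp only [f, dif_pos ht]
  have hfc : Filter.Tendsto f (𝓝[≠] 0) (𝓝 J') := by
    refine tendsto_subtype_rng.2 ?_
    have hs : Continuous (matrixEquiv n).symm :=
      (matrixEquiv n).symm.toLinearMap.continuous_of_finiteDimensional
    have h := (hs.tendsto _).comp hMc
    rw [LinearEquiv.symm_apply_apply] at h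
    exact h.congr' (hdet.mono fun t ht => (hf t ht).symm)
  refine mem_closure_of_tendsto (tendsto_const_nhds.prodMk_nhds hfc) ?_
  filter_upwards [hdet, Matrix.traceDiscr_conj_eventually_ne_zero hGJ] with t ht h
  rw [pairDiscr_eq, hf t ht, LinearEquiv.apply_symm_apply]
  exact h

end Genericity

theorem proposition2p2 (n k : ℕ) (hk : k ≤ n) :
    (∃ U : Set (ComplexStructure n × ComplexStructure n), IsOpen U ∧ Dense U ∧
      U ⊆ {p | OrientedGr.IntersectTransversally (complexGr k p.1) (complexGr k p.2) ∧
        (complexGr k p.1 ∩ complexGr k p.2).Finite}) ∧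
    (∃ U : Set (ComplexStructure n × ComplexStructure n), IsOpen U ∧ Dense U ∧
      U ⊆ {p | OrientedGr.IntersectTransversally (complexGr k p.1)
          (OrientedGr.tau '' complexGr k p.2) ∧
        (complexGr k p.1 ∩ OrientedGr.tau '' complexGr k p.2).Finite}) := by
  have hopen : IsOpen {p : ComplexStructure n × ComplexStructure n | pairDiscr p ≠ 0} :=
    isOpen_ne_fun (continuous_pairDiscr n) continuous_const
  exact ⟨⟨_, hopen, dense_setOf_pairDiscr_ne_zero n, fun p hp =>
      ⟨intersectTransversally_of_pairDiscr_ne_zero hp, finite_inter_of_pairDiscr_ne_zero hp⟩⟩,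
    ⟨_, hopen, dense_setOf_pairDiscr_ne_zero n, fun p hp =>
      ⟨intersectTransversally_tau_of_pairDiscr_ne_zero hp,
        finite_inter_tau_of_pairDiscr_ne_zero hp⟩⟩⟩
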